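/- All graphs are finite, simple and undirected. A graph is distance-hereditary if it has no induced subgraph isomorphic to a gem (a path $P_4$ together with a vertex adjacent to all four of its vertices), a house (the complement of the path $P_5$), a domino (the cycle $C_6$ with one chord joining two opposite vertices) or a hole (a cycle $C_k$ with $k\ge 5$). An induced $P_4$ $abcd$ of $G$ is an induced path on four vertices with edges $ab, bc, cd$; its end-edges are $ab$ and $cd$. An orientation of $G$ replaces each edge $xy$ by exactly one of $x\to y$ and $y\to x$; it is acyclic if it has no directed cycle. A graph is a coalition graph if it admits an acyclic orientation such that, for every induced $P_4$ $abcd$, the end-edges are oriented in the same way: $a\to b$ if and only if $c\to d$. A graph is a comparability graph if it admits an acyclic orientation such that $a\to b$ and $b\to c$ imply $a\to c$. For a graph $G$, the graph $\mathscr{C}(G)$ has as vertices the ordered pairs $(x,y)$ such that $\{x,y\}$ is an end-edge of an induced $P_4$ in $G$; two vertices $(x,y)$ and $(u,v)$ are adjacent if $(x,y)=(v,u)$, or $xyvu$ or $vuxy$ is an induced $P_4$ in $G$. Let $\mathsf{N}$ be the graph on six vertices consisting of a triangle with one pendant vertex attached to each of its three vertices. Theorem. Let $G$ be a distance-hereditary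 graph. The following statements are equivalent: (i) $G$ is a coalition graph; (ii) $\mathscr{C}(G)$ is bipartite; (iii) $G$ is $\mathsf{N}$-free, that is, $G$ has no induced subgraph isomorphic to $\mathsf{N}$; (iv) $G$ is a comparability graph. In particular, a distance-hereditary graph is a coalition graph if and only if it is a comparability graph. -/

import Mathlib

namespace SimpleGraph

/-- The gem: the path `0 1 2 3` together with a vertex `4` adjacent to all four path vertices. -/
def gemGraph : SimpleGraph (Fin 5) :=
  fromEdgeSet {s(0, 1), s(1, 2), s(2, 3), s(4, 0), s(4, 1), s(4, 2), s(4, 3)}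

/-- The house: the complement of the path with five vertices. -/
def houseGraph : SimpleGraph (Fin 5) := (pathGraph 5)ᶜ

/-- The domino: the cycle `0 1 2 3 4 5` with the chord joining the opposite vertices `0` and `3`. -/
def dominoGraph : SimpleGraph (Fin 6) := cycleGraph 6 ⊔ edge 0 3

/-- The graph `N`: the triangle `0 1 2` with a pendant vertex attached to each triangle vertex. -/
def netGraph : SimpleGraph (Fin 6) :=
  fromEdgeSet {s(0, 1), s(1, 2), s(0, 2), s(0, 3), s(1, 4), s(2, 5)}

/-- A graph is distance-hereditary if it has no gem, no house, no domino and no hole (a cycle of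
length at least five) as an induced subgraph. -/
structure IsDistanceHereditary {V : Type*} (G : SimpleGraph V) : Prop where
  gem_free : ¬ gemGraph.IsIndContained G
  house_free : ¬ houseGraph.IsIndContained G
  domino_free : ¬ dominoGraph.IsIndContained G
  hole_free : ∀ k : ℕ, 5 ≤ k → ¬ (cycleGraph k).IsIndContained G

/-- `a b c d` is an induced path with four vertices: its edges are exactly `ab`, `bc`, `cd`.
(The six conditions force the four vertices to be distinct.) -/
structure IsInducedP4 {V : Type*} (G : SimpleGraph V) (a b c d : V) : Prop where
  adj_ab : G.Adj a b
  adj_bc : G.Adj b c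
  adj_cd : G.Adj c d
  not_adj_ac : ¬ G.Adj a c
  not_adj_bd : ¬ G.Adj b d
  not_adj_ad : ¬ G.Adj a d

/-- `{x, y}` is an end-edge of some induced `P₄` of `G`. -/
def IsP4EndEdge {V : Type*} (G : SimpleGraph V) (x y : V) : Prop :=
  ∃ a b c d, G.IsInducedP4 a b c d ∧ (s(x, y) = s(a, b) ∨ s(x, y) = s(c, d))

/-- `D` is an orientation of `G`: each edge `xy` of `G` is replaced by exactly one of the arcs
`x → y` and `y → x`, and `D` has no other arcs. -/
structure IsOrientation {V : Type*} (G : SimpleGraph V) (D : Digraph V) : Prop where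
  adj_iff : ∀ x y, G.Adj x y ↔ D.Adj x y ∨ D.Adj y x
  asymm : ∀ x y, D.Adj x y → ¬ D.Adj y x

/-- `D` is an acyclic orientation of `G`: an orientation without directed cycles, that is, no
vertex can be reached from itself along a nonempty sequence of arcs. -/
structure IsAcyclicOrientation {V : Type*} (G : SimpleGraph V) (D : Digraph V) : Prop
    extends IsOrientation G D where
  acyclic : ∀ x, ¬ Relation.TransGen D.Adj x x

/-- A coalition graph has an acyclic orientation in which the two end-edges `ab` and `cd` of every
induced `P₄` `abcd` are oriented in the same way. -/
def IsCoalition {V : Type*} (G : SimpleGraph V) : Prop :=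
  ∃ D : Digraph V, G.IsAcyclicOrientation D ∧
    ∀ a b c d, G.IsInducedP4 a b c d → (D.Adj a b ↔ D.Adj c d)

/-- A comparability graph has an acyclic orientation that is transitive. -/
def IsComparability {V : Type*} (G : SimpleGraph V) : Prop :=
  ∃ D : Digraph V, G.IsAcyclicOrientation D ∧
    ∀ a b c, D.Adj a b → D.Adj b c → D.Adj a c

/-- The auxiliary graph `𝒞(G)`. Its vertices are the ordered pairs `(x, y)` such that `{x, y}` is
an end-edge of an induced `P₄` of `G`; two vertices `(x, y)` and `(u, v)` are adjacent if
`(x, y) = (v, u)`, or `x y v u` or `v u x y` is an induced `P₄` of `G`. -/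
def coalitionAux {V : Type*} (G : SimpleGraph V) :
    SimpleGraph {p : V × V // G.IsP4EndEdge p.1 p.2} where
  Adj p q := p.1 = (q.1.2, q.1.1) ∨
    G.IsInducedP4 p.1.1 p.1.2 q.1.2 q.1.1 ∨ G.IsInducedP4 q.1.2 q.1.1 p.1.1 p.1.2
  symm := ⟨by
    rintro ⟨⟨x, y⟩, _⟩ ⟨⟨u, v⟩, _⟩ (h | h | h)
    · simp only [Prod.mk.injEq] at h
      exact Or.inl (by simp [h.1, h.2])
    · exact Or.inr (Or.inl ⟨h.adj_cd.symm, h.adj_bc.symm, h.adj_ab.symm,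
        fun k => h.not_adj_bd k.symm, fun k => h.not_adj_ac k.symm, fun k => h.not_adj_ad k.symm⟩)
    · exact Or.inr (Or.inr ⟨h.adj_cd.symm, h.adj_bc.symm, h.adj_ab.symm,
        fun k => h.not_adj_bd k.symm, fun k => h.not_adj_ac k.symm, fun k => h.not_adj_ad k.symm⟩)⟩
  loopless := ⟨by
    rintro ⟨⟨x, y⟩, a, b, c, d, hP, he⟩ (h | h | h)
    · simp only [Prod.mk.injEq] at h
      obtain ⟨rfl, -⟩ := h
      rcases he with he | he
      · have : G.Adj x x := by
          rw [← mem_edgeSet, he]; exact hP.adj_ab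
        exact G.irrefl this
      · have : G.Adj x x := by
          rw [← mem_edgeSet, he]; exact hP.adj_cd
        exact G.irrefl this
    · exact G.irrefl h.adj_bc
    · exact G.irrefl h.adj_bc⟩

end SimpleGraph

/-!
The substantial implication is that a distance-hereditary graph `G` without net is a comparability
graph. Its transitive orientation is given explicitly in terms of the levels of `G`, that is, of the
distance from a root chosen in each component.

Adjacent vertices of one level have the same neighbours in the previous level
(`Levelling.adj_lower`), because otherwise a house, a gem or a hole appears below them. Hence a
component of a level has a common lower neighbour, and the absence of gems makes it free of induced
paths on four vertices. The absence of nets makes the upper neighbourhoods of adjacent vertices `x`,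
`y` of one level comparable (`Levelling.upper_comparable`): private upper neighbours of `x` and `y`,
a common lower neighbour `p`, and a lower neighbour of `p` would form a net. On the first level `p`
is the root and has no lower neighbour, so the root must be chosen with care: it may not be the nose
of an induced bull. A vertex of the last level (for any choice of roots) with a smallest lower
neighbourhood has this property (`Levelling.not_isBullNose`).

A graph without induced path on four vertices is recursively a disjoint union or a join of two
parts. If its vertices carry sets that are comparable along edges, and the set of the middle vertex
of an induced path `x y z` is contained in both end sets or in none, then the join can be chosen such
that all sets on one side are contained in all sets on the other (`exists_monotone_join`). So there
is a transitive orientation along which the sets grow (`exists_isMonotoneOrientation`). With the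
upper neighbourhoods as sets, this orients the edges within the levels; it is reversed on the even
levels, and the edges between levels go from even to odd ones. Whenever `x → y` within an odd level,
every neighbour of `x` in another level is a neighbour of `y`, which is what transitivity asks for
(`Levelling.arc_trans`); the even levels are symmetric.

Of the other implications, a transitive orientation alternates along induced paths, so it orients
both end-edges of an induced path on four vertices in the same way; such an orientation colours the
auxiliary graph; and the pendant edges of a net form a triangle in the auxiliary graph.
-/

namespace SimpleGraph

variable {V : Type*} {G : SimpleGraph V}

/-! ### Recognizing the forbidden subgraphs -/

/-- A graph without two vertices of equal neighbourhood is found as an induced subgraph by giving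
the images of its vertices and checking each pair once. -/
theorem isIndContained_of_adj_iff {n : ℕ} {K : SimpleGraph (Fin n)}
    (hK : ∀ i j, (∀ k, K.Adj i k ↔ K.Adj j k) → i = j) (f : Fin n → V)
    (hf : ∀ i j, i < j → (G.Adj (f i) (f j) ↔ K.Adj i j)) : K.IsIndContained G := by
  have hf' : ∀ i j, G.Adj (f i) (f j) ↔ K.Adj i j := by
    intro i j
    rcases lt_trichotomy i j with hij | rfl | hij
    · exact hf i j hij
    · simp
    · rw [G.adj_comm, K.adj_comm]
      exact hf j i hij
  exact ⟨⟨⟨f, fun i j h => hK i j fun k => by rw [← hf', ← hf', h]⟩, hf' _ _⟩⟩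

theorem IsDistanceHereditary.false_of_gem (hG : G.IsDistanceHereditary) {a b c d u : V}
    (h : G.IsInducedP4 a b c d) (ua : G.Adj u a) (ub : G.Adj u b) (uc : G.Adj u c)
    (ud : G.Adj u d) : False := by
  obtain ⟨h1, h2, h3, h4, h5, h6⟩ := h
  have := ua.symm
  have := ub.symm
  have := uc.symm
  have := ud.symm
  refine hG.gem_free (isIndContained_of_adj_iff (fun i j h => ?_) ![a, b, c, d, u] fun i j h => ?_)
  · simp only [gemGraph, fromEdgeSet_adj, Fin.forall_fin_succ] at h
    fin_cases i <;> fin_cases j <;> simp_all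
  · fin_cases i <;> fin_cases j <;> first | exact absurd h (by decide) | simp [gemGraph, *]

theorem IsDistanceHereditary.false_of_house (hG : G.IsDistanceHereditary) {a b c d e : V}
    (ab : G.Adj a b) (bc : G.Adj b c) (cd : G.Adj c d) (da : G.Adj d a)
    (ac : ¬ G.Adj a c) (bd : ¬ G.Adj b d)
    (ea : G.Adj e a) (eb : G.Adj e b) (ec : ¬ G.Adj e c) (ed : ¬ G.Adj e d) : False := by
  have := da.symm
  have := ea.symm
  have := bc.symm
  have ce : ¬ G.Adj c e := fun h => ec h.symm
  have db : ¬ G.Adj d b := fun h => bd h.symm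
  refine hG.house_free
    (isIndContained_of_adj_iff (fun i j h => ?_) ![a, c, e, d, b] fun i j h => ?_)
  · simp only [houseGraph, compl_adj, pathGraph_adj, Fin.forall_fin_succ] at h
    fin_cases i <;> fin_cases j <;> simp_all
  · fin_cases i <;> fin_cases j <;>
      first | exact absurd h (by decide) | simp [houseGraph, pathGraph_adj, *]

theorem netGraph_adj (i j : Fin 6) : netGraph.Adj i j ↔
    ((i : ℕ) < 3 ∧ (j : ℕ) < 3 ∧ i ≠ j) ∨ (i : ℕ) + 3 = j ∨ (j : ℕ) + 3 = i := by
  simp only [netGraph, fromEdgeSet_adj]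
  fin_cases i <;> fin_cases j <;> simp

theorem isIndContained_netGraph {a b c a' b' c' : V}
    (ab : G.Adj a b) (bc : G.Adj b c) (ac : G.Adj a c)
    (haa : G.Adj a a') (hbb : G.Adj b b') (hcc : G.Adj c c')
    (hab : ¬ G.Adj a b') (hac : ¬ G.Adj a c') (hba : ¬ G.Adj b a') (hbc : ¬ G.Adj b c')
    (hca : ¬ G.Adj c a') (hcb : ¬ G.Adj c b')
    (hab' : ¬ G.Adj a' b') (hac' : ¬ G.Adj a' c') (hbc' : ¬ G.Adj b' c') :
    netGraph.IsIndContained G := by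
  refine isIndContained_of_adj_iff (fun i j h => ?_) ![a, b, c, a', b', c'] fun i j h => ?_
  · simp only [netGraph_adj] at h
    revert i j
    decide
  · rw [netGraph_adj]
    fin_cases i <;> fin_cases j <;> first | exact absurd h (by decide) | simpa

theorem isIndContained_cycleGraph {n : ℕ} (f : ℕ → V)
    (hinj : ∀ i j, i < j → j ≤ n → f i ≠ f j)
    (hf : ∀ i j, i < j → j ≤ n → (G.Adj (f i) (f j) ↔ j = i + 1 ∨ i = 0 ∧ j = n)) :
    (cycleGraph (n + 1)).IsIndContained G := by
  have key : ∀ i j : Fin (n + 1), i < j →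
      (G.Adj (f i) (f j) ↔ (cycleGraph (n + 1)).Adj i j) := by
    intro i j hij
    rw [hf i j hij (by omega), cycleGraph_adj', Fin.val_sub, Fin.val_sub]
    have hi := i.2
    have hj := j.2
    have hij' : (i : ℕ) < j := hij
    have e1 : (n + 1 - (j : ℕ) + i) % (n + 1) = n + 1 - j + i := Nat.mod_eq_of_lt (by omega)
    have e2 : (n + 1 - (i : ℕ) + j) % (n + 1) = j - i := by
      rw [show n + 1 - (i : ℕ) + j = j - i + (n + 1) by omega, Nat.add_mod_right,
        Nat.mod_eq_of_lt (by omega)]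
    rw [e1, e2]
    omega
  refine ⟨⟨⟨fun i => f i, fun i j h => ?_⟩, fun {i j} => ?_⟩⟩
  · rcases lt_trichotomy i j with hij | hij | hij
    · exact absurd h (hinj i j hij (by omega))
    · exact hij
    · exact absurd h.symm (hinj j i hij (by omega))
  · rcases lt_trichotomy i j with hij | rfl | hij
    · exact key i j hij
    · simp
    · rw [G.adj_comm, (cycleGraph (n + 1)).adj_comm]
      exact key j i hij

/-! ### Short connections in graphs without holes -/

/-- The graph on the vertices of `G` whose edges are the edges of `G` with both ends in `B`. -/
def within (G : SimpleGraph V) (B : Set V) : SimpleGraph V where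
  Adj x y := x ∈ B ∧ y ∈ B ∧ G.Adj x y
  symm := ⟨fun _ _ h => ⟨h.2.1, h.1, h.2.2.symm⟩⟩
  loopless := ⟨fun _ h => G.irrefl h.2.2⟩

theorem within_mono {B C : Set V} (h : B ⊆ C) : G.within B ≤ G.within C :=
  fun _ _ k => ⟨h k.1, h k.2.1, k.2.2⟩

/-- If two nonadjacent neighbours `p`, `q` of `x` are joined by a path whose interior avoids `x` and
its neighbours, then a shortest such path closes up with `x` to an induced cycle; as there is no
hole, the cycle has length four. -/
theorem IsDistanceHereditary.exists_common_neighbor (hG : G.IsDistanceHereditary) {B : Set V}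
    {x p q : V} (hxp : G.Adj x p) (hxq : G.Adj x q) (hpq : ¬ G.Adj p q) (hne : p ≠ q)
    (hB : ∀ b ∈ B, ¬ G.Adj x b) (hxB : x ∉ B)
    (hr : (G.within (insert p (insert q B))).Reachable p q) :
    ∃ s ∈ B, G.Adj p s ∧ G.Adj q s := by
  obtain ⟨w, hw⟩ := hr.exists_walk_length_eq_dist
  set n := w.length
  set f := w.getVert
  have f0 : f 0 = p := w.getVert_zero
  have fn : f n = q := w.getVert_length
  have hsucc : ∀ i, i < n →
      (G.within (insert p (insert q B))).Adj (f i) (f (i + 1)) :=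
    fun i hi => w.adj_getVert_succ hi
  have hfar : ∀ i j, i < j → j ≤ n →
      (G.within (insert p (insert q B))).Adj (f i) (f j) →
      j = i + 1 := by
    intro i j hij hj hadj
    have := SimpleGraph.dist_le ((w.take i).append (Walk.cons hadj (w.drop j)))
    simp only [Walk.length_append, Walk.length_cons, Walk.take_length, Walk.drop_length] at this
    have := min_le_left i w.length
    omega
  have hinj : ∀ i j, i < j → j ≤ n → f i ≠ f j := by
    intro i j hij hj heq
    have := SimpleGraph.dist_le ((w.take i).append ((w.drop j).copy heq.symm rfl))
    simp only [Walk.length_append, Walk.length_copy, Walk.take_length, Walk.drop_length] at this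
    have := min_le_left i w.length
    omega
  have n0 : n ≠ 0 := fun h => hne (by rw [← f0, ← fn, h])
  have n1 : n ≠ 1 := fun h => hpq (by
    have := (hsucc 0 (by omega)).2.2
    rwa [f0, zero_add, ← h, fn] at this)
  have hmem : ∀ i, i ≤ n → f i ∈ insert p (insert q B) := by
    intro i hi
    rcases hi.lt_or_eq with h | h
    · exact (hsucc i h).1
    · rw [h, fn]; simp
  have hmemB : ∀ i, 0 < i → i < n → f i ∈ B := by
    intro i h0 hi
    rcases hmem i hi.le with h | h | h
    · exact absurd (f0.trans h.symm) (hinj 0 i h0 hi.le)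
    · exact absurd (h.trans fn.symm) (hinj i n hi le_rfl)
    · exact h
  rcases (show n = 2 ∨ 3 ≤ n by omega) with h2 | h3
  · refine ⟨f 1, hmemB 1 (by omega) (by omega), ?_, ?_⟩
    · rw [← f0]; exact (hsucc 0 (by omega)).2.2
    · rw [← fn, h2]; exact (hsucc 1 (by omega)).2.2.symm
  · exfalso
    refine hG.hole_free (n + 1 + 1) (by omega)
      (isIndContained_cycleGraph (fun i => if i ≤ n then f i else x) ?_ ?_)
    · intro i j hij hj
      rcases (show j ≤ n ∨ j = n + 1 by omega) with h | h
      · simpa [h, (hij.le.trans h)] using hinj i j hij h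
      · simp only [h, show i ≤ n by omega, if_true, show ¬ n + 1 ≤ n by omega, if_false]
        intro heq
        rcases hmem i (by omega) with k | k | k
        · exact hxp.ne (heq.symm.trans k)
        · exact hxq.ne (heq.symm.trans k)
        · exact hxB (heq ▸ k)
    · intro i j hij hj
      rcases (show j ≤ n ∨ j = n + 1 by omega) with h | rfl
      · simp only [h, (hij.le.trans h), if_true]
        constructor
        · intro hadj
          exact Or.inl (hfar i j hij h ⟨hmem i (by omega), hmem j h, hadj⟩)
        · rintro (rfl | hh)
          · exact (hsucc i (by omega)).2.2
          · omega
      · rw [if_pos (by omega : i ≤ n), if_neg (by omega : ¬ n + 1 ≤ n)]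
        constructor
        · intro hadj
          by_contra hcon
          have hi : 0 < i ∧ i < n := by omega
          exact hB _ (hmemB i hi.1 hi.2) hadj.symm
        · intro hi
          rcases (show i = 0 ∨ i = n by omega) with rfl | rfl
          · rw [f0]; exact hxp.symm
          · rw [fn]; exact hxq.symm

/-! ### Transitive orientations of graphs without induced paths on four vertices -/

theorem IsInducedP4.of_compl {a b c d : V} (h : Gᶜ.IsInducedP4 a b c d) :
    G.IsInducedP4 b d a c := by
  obtain ⟨h1, h2, h3, h4, h5, h6⟩ := h
  have hbd : b ≠ d := by rintro rfl; exact h6 h1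
  have hac : a ≠ c := by rintro rfl; exact h6 h3
  have had : a ≠ d := by rintro rfl; exact h5 h1.symm
  simp only [compl_adj, not_and, not_not] at *
  exact ⟨h5 hbd, (h6 had).symm, h4 hac, fun h => h1.2 h.symm, fun h => h3.2 h.symm, h2.2⟩

/-- A proper nonempty part of `s` that is joined to the rest of `s` by no edge or by all edges. -/
def HasSplit (G : SimpleGraph V) (s : Set V) : Prop :=
  ∃ A ⊆ s, A.Nonempty ∧ (s \ A).Nonempty ∧
    ((∀ a ∈ A, ∀ b ∈ s \ A, ¬ G.Adj a b) ∨ ∀ a ∈ A, ∀ b ∈ s \ A, G.Adj a b)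

theorem HasSplit.of_compl {s : Set V} (h : Gᶜ.HasSplit s) : G.HasSplit s := by
  obtain ⟨A, hA, hA1, hA2, h⟩ := h
  refine ⟨A, hA, hA1, hA2, ?_⟩
  have hne : ∀ a ∈ A, ∀ b ∈ s \ A, a ≠ b := fun a ha b hb hab => hb.2 (hab ▸ ha)
  rcases h with h | h
  · right
    intro a ha b hb
    by_contra hab
    exact h a ha b hb ⟨hne a ha b hb, hab⟩
  · left
    exact fun a ha b hb => (h a ha b hb).2

theorem hasSplit_insert_of_not_adj (h4 : ∀ a b c d, ¬ G.IsInducedP4 a b c d) {s A : Set V} {v : V}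
    (hv : v ∉ s) (hAs : A ⊆ s) (hA : A.Nonempty) (hB : (s \ A).Nonempty)
    (hAB : ∀ a ∈ A, ∀ b ∈ s \ A, ¬ G.Adj a b) : G.HasSplit (insert v s) := by
  have hvA : v ∉ A := fun h => hv (hAs h)
  by_cases hall : ∀ a ∈ s, G.Adj v a
  · refine ⟨s, Set.subset_insert v s, hA.mono hAs, ⟨v, by simp, hv⟩, Or.inr ?_⟩
    rintro a ha b ⟨rfl | hb, hb'⟩
    · exact (hall a ha).symm
    · exact absurd hb hb'
  by_cases hnA : ∀ a ∈ A, ¬ G.Adj a v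
  · refine ⟨A, hAs.trans (Set.subset_insert v s), hA, ⟨v, by simp, hvA⟩, Or.inl ?_⟩
    rintro a ha b ⟨rfl | hb, hb'⟩
    · exact hnA a ha
    · exact hAB a ha b ⟨hb, hb'⟩
  by_cases hnB : ∀ b ∈ s \ A, ¬ G.Adj b v
  · refine ⟨s \ A, Set.sdiff_subset.trans (Set.subset_insert v s), hB,
      ⟨v, by simp, fun h => hv h.1⟩, Or.inl ?_⟩
    rintro b hb a ⟨rfl | ha, ha'⟩
    · exact hnB b hb
    · by_cases haA : a ∈ A
      · exact fun h => hAB a haA b hb h.symm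
      · exact absurd ⟨ha, haA⟩ ha'
  push Not at hall hnA hnB
  obtain ⟨w, hws, hvw⟩ := hall
  obtain ⟨a, haA, hav⟩ := hnA
  obtain ⟨b, hbB, hbv⟩ := hnB
  -- The non-neighbours of `v` on the side of `w` have no neighbour outside: an edge to a
  -- neighbour of `v` on that side would extend through `v` to an induced path.
  by_cases hwA : w ∈ A
  · refine ⟨{x ∈ A | ¬ G.Adj v x}, fun x hx => Or.inr (hAs hx.1), ⟨w, hwA, hvw⟩,
      ⟨v, by simp, fun h => hvA h.1⟩, Or.inl ?_⟩
    rintro x ⟨hxA, hvx⟩ y ⟨rfl | hy, hy'⟩ hxy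
    · exact hvx hxy.symm
    · by_cases hyA : y ∈ A
      · have hvy : G.Adj v y := by
          by_contra h
          exact hy' ⟨hyA, h⟩
        exact h4 x y v b ⟨hxy, hvy.symm, hbv.symm, fun h => hvx h.symm, hAB y hyA b hbB,
          hAB x hxA b hbB⟩
      · exact hAB x hxA y ⟨hy, hyA⟩ hxy
  · refine ⟨{x ∈ s \ A | ¬ G.Adj v x}, fun x hx => Or.inr hx.1.1, ⟨w, ⟨hws, hwA⟩, hvw⟩,
      ⟨v, by simp, fun h => hv h.1.1⟩, Or.inl ?_⟩
    rintro x ⟨hxB, hvx⟩ y ⟨rfl | hy, hy'⟩ hxy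
    · exact hvx hxy.symm
    · by_cases hyA : y ∈ A
      · exact hAB y hyA x hxB hxy.symm
      · have hvy : G.Adj v y := by
          by_contra h
          exact hy' ⟨⟨hy, hyA⟩, h⟩
        exact h4 x y v a ⟨hxy, hvy.symm, hav.symm, fun h => hvx h.symm,
          fun h => hAB a haA y ⟨hy, hyA⟩ h.symm, fun h => hAB a haA x hxB h.symm⟩

/-- A graph without induced path on four vertices is disconnected or its complement is, as soon as
it has two vertices. -/
theorem hasSplit_of_nontrivial [Finite V] (h4 : ∀ a b c d, ¬ G.IsInducedP4 a b c d) (s : Set V)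
    (hs : s.Nontrivial) : G.HasSplit s := by
  induction s, s.toFinite using Set.Finite.induction_on with
  | empty => exact absurd hs (by simp)
  | @insert v s hv _ ih =>
    by_cases hs' : s.Nontrivial
    · obtain ⟨A, hA, hA1, hA2, h | h⟩ := ih hs'
      · exact hasSplit_insert_of_not_adj h4 hv hA hA1 hA2 h
      · exact (hasSplit_insert_of_not_adj (G := Gᶜ)
          (fun a b c d hP => h4 _ _ _ _ hP.of_compl) hv hA hA1 hA2
          fun a ha b hb hab => hab.2 (h a ha b hb)).of_compl
    · rw [Set.not_nontrivial_iff] at hs'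
      obtain ⟨x, hx, y, hy, hxy⟩ := hs
      have hne : s.Nonempty := by
        rcases hx with rfl | hx
        · rcases hy with rfl | hy
          · exact absurd rfl hxy
          · exact ⟨y, hy⟩
        · exact ⟨x, hx⟩
      obtain ⟨z, hz⟩ := hne
      have hsz : s = {z} := hs'.eq_singleton_of_mem hz
      subst hsz
      refine ⟨{z}, Set.subset_insert _ _, ⟨z, rfl⟩, ⟨v, by simp, hv⟩, ?_⟩
      by_cases hzv : G.Adj z v
      · right
        rintro a rfl b ⟨rfl | hb, hb'⟩
        · exact hzv
        · exact absurd hb hb'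
      · left
        rintro a rfl b ⟨rfl | hb, hb'⟩
        · exact hzv
        · exact absurd hb hb'

/-- A transitive orientation, given as the relation `T`, of the part of `G` induced by `s`, along
which the labels `S` grow. -/
structure IsMonotoneOrientation {ι : Type*} (G : SimpleGraph V) (S : V → Set ι) (s : Set V)
    (T : V → V → Prop) : Prop where
  adj : ∀ x y, T x y → G.Adj x y
  left_mem : ∀ x y, T x y → x ∈ s
  right_mem : ∀ x y, T x y → y ∈ s
  total : ∀ x ∈ s, ∀ y ∈ s, G.Adj x y → T x y ∨ T y x
  trans : ∀ x y z, T x y → T y z → T x z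
  subset : ∀ x y, T x y → S x ⊆ S y

/-- In a join `A ∪ B` in which the label of `x ∈ B` is largest and `B` is a smallest possible
side containing `x`, every label in `A` is contained in every label in `B`: the members of `B`
whose label contains all labels of `A` are joined to the other members of `B`. -/
theorem exists_monotone_join [Finite V] {ι : Type*} [Finite ι] {S : V → Set ι}
    (hcomp : ∀ x y, G.Adj x y → S x ⊆ S y ∨ S y ⊆ S x)
    (hP3 : ∀ x y z, G.Adj x y → G.Adj y z → x ≠ z → ¬ G.Adj x z → S y ⊆ S x → S y ⊆ S z)
    {s A : Set V} (hAs : A ⊆ s) (hA : A.Nonempty) (hB : (s \ A).Nonempty)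
    (hAB : ∀ a ∈ A, ∀ b ∈ s \ A, G.Adj a b) :
    ∃ A ⊆ s, A.Nonempty ∧ (s \ A).Nonempty ∧
      ∀ a ∈ A, ∀ b ∈ s \ A, G.Adj a b ∧ S a ⊆ S b := by
  obtain ⟨x, hxs, hx⟩ := s.toFinite.exists_maximalFor (fun x => (S x).ncard) s (hA.mono hAs)
  let F : Set (Set V) := {B | B ⊆ s ∧ x ∈ B ∧ (s \ B).Nonempty ∧
    ∀ a ∈ s \ B, ∀ b ∈ B, G.Adj a b}
  have hF : F.Nonempty := by
    by_cases hxA : x ∈ A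
    · exact ⟨A, hAs, hxA, hB, fun a ha b hb => (hAB b hb a ha).symm⟩
    · refine ⟨s \ A, Set.sdiff_subset, ⟨hxs, hxA⟩, ?_, ?_⟩
      · rwa [Set.sdiff_sdiff_cancel_left hAs]
      · rwa [Set.sdiff_sdiff_cancel_left hAs]
  obtain ⟨B, hBmin⟩ := F.toFinite.exists_minimal hF
  obtain ⟨hBs, hxB, hBne, hBadj⟩ := hBmin.1
  have hSx : ∀ a ∈ s \ B, S a ⊆ S x := by
    intro a ha
    rcases hcomp a x (hBadj a ha x hxB) with h | h
    · exact h
    · exact (Set.eq_of_subset_of_ncard_le h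
        (hx ha.1 (Set.ncard_le_ncard h (Set.toFinite _))) (Set.toFinite _)).ge
  let B' : Set V := {b ∈ B | ∀ a ∈ s \ B, S a ⊆ S b}
  have hB' : B' ∈ F := by
    refine ⟨fun b hb => hBs hb.1, ⟨hxB, hSx⟩,
      hBne.mono fun a ha => ⟨ha.1, fun h => ha.2 h.1⟩, ?_⟩
    rintro c ⟨hcs, hcB'⟩ b ⟨hbB, hb⟩
    by_cases hcB : c ∈ B
    · by_contra hcb
      refine hcB' ⟨hcB, fun a ha => hP3 b a c (hBadj a ha b hbB).symm (hBadj a ha c hcB) ?_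
        (fun h => hcb h.symm) (hb a ha)⟩
      rintro rfl
      exact hcB' ⟨hbB, hb⟩
    · exact hBadj c ⟨hcs, hcB⟩ b hbB
  have hle : B ⊆ B' := hBmin.2 hB' fun b hb => hb.1
  refine ⟨s \ B, Set.sdiff_subset, hBne, ⟨x, hxs, fun h => h.2 hxB⟩, ?_⟩
  intro a ha b hb
  rw [Set.sdiff_sdiff_cancel_left hBs] at hb
  exact ⟨hBadj a ha b hb, (hle hb).2 a ha⟩

/-- Transitive orientations of the two sides of a split, together with all arcs from the first
side to the second in the case of a join, form a transitive orientation. -/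
theorem exists_isMonotoneOrientation_of_split {ι : Type*} {S : V → Set ι} {s A : Set V}
    {T₁ T₂ : V → V → Prop} (h₁ : G.IsMonotoneOrientation S A T₁)
    (h₂ : G.IsMonotoneOrientation S (s \ A) T₂) (hAs : A ⊆ s)
    (h : (∀ a ∈ A, ∀ b ∈ s \ A, ¬ G.Adj a b) ∨ ∀ a ∈ A, ∀ b ∈ s \ A, G.Adj a b ∧ S a ⊆ S b) :
    ∃ T, G.IsMonotoneOrientation S s T := by
  refine ⟨fun x y => T₁ x y ∨ T₂ x y ∨ (G.Adj x y ∧ x ∈ A ∧ y ∈ s \ A), ?_, ?_, ?_, ?_, ?_, ?_⟩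
  · rintro x y (k | k | k)
    · exact h₁.adj x y k
    · exact h₂.adj x y k
    · exact k.1
  · rintro x y (k | k | k)
    · exact hAs (h₁.left_mem x y k)
    · exact (h₂.left_mem x y k).1
    · exact hAs k.2.1
  · rintro x y (k | k | k)
    · exact hAs (h₁.right_mem x y k)
    · exact (h₂.right_mem x y k).1
    · exact k.2.2.1
  · intro x hx y hy hxy
    by_cases hxA : x ∈ A <;> by_cases hyA : y ∈ A
    · exact (h₁.total x hxA y hyA hxy).imp Or.inl Or.inl
    · exact Or.inl (Or.inr (Or.inr ⟨hxy, hxA, hy, hyA⟩))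
    · exact Or.inr (Or.inr (Or.inr ⟨hxy.symm, hyA, hx, hxA⟩))
    · exact (h₂.total x ⟨hx, hxA⟩ y ⟨hy, hyA⟩ hxy).imp (Or.inr ∘ Or.inl) (Or.inr ∘ Or.inl)
  · have hj : ∀ x y, G.Adj x y → x ∈ A → y ∈ s \ A → ∀ a ∈ A, ∀ b ∈ s \ A, G.Adj a b := by
      intro x y hxy hx hy a ha b hb
      rcases h with h | h
      · exact absurd hxy (h x hx y hy)
      · exact (h a ha b hb).1
    rintro x y z (k | k | k) (l | l | l)
    · exact Or.inl (h₁.trans x y z k l)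
    · exact absurd (h₁.right_mem x y k) (h₂.left_mem y z l).2
    · have hx := h₁.left_mem x y k
      exact Or.inr (Or.inr ⟨hj _ _ l.1 l.2.1 l.2.2 x hx z l.2.2, hx, l.2.2⟩)
    · exact absurd (h₁.left_mem y z l) (h₂.right_mem x y k).2
    · exact Or.inr (Or.inl (h₂.trans x y z k l))
    · exact absurd l.2.1 (h₂.right_mem x y k).2
    · exact absurd (h₁.left_mem y z l) k.2.2.2
    · have hz := h₂.right_mem y z l
      exact Or.inr (Or.inr ⟨hj _ _ k.1 k.2.1 k.2.2 x k.2.1 z hz, k.2.1, hz⟩)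
    · exact absurd l.2.1 k.2.2.2
  · rintro x y (k | k | k)
    · exact h₁.subset x y k
    · exact h₂.subset x y k
    · rcases h with h | h
      · exact absurd k.1 (h x k.2.1 y k.2.2)
      · exact (h x k.2.1 y k.2.2).2

theorem exists_isMonotoneOrientation [Finite V] {ι : Type*} [Finite ι]
    (h4 : ∀ a b c d, ¬ G.IsInducedP4 a b c d) {S : V → Set ι}
    (hcomp : ∀ x y, G.Adj x y → S x ⊆ S y ∨ S y ⊆ S x)
    (hP3 : ∀ x y z, G.Adj x y → G.Adj y z → x ≠ z → ¬ G.Adj x z → S y ⊆ S x → S y ⊆ S z)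
    (s : Set V) : ∃ T, G.IsMonotoneOrientation S s T := by
  induction hn : s.ncard using Nat.strong_induction_on generalizing s with
  | _ n ih =>
  by_cases hs : s.Nontrivial
  · have main : ∃ A ⊆ s, A.Nonempty ∧ (s \ A).Nonempty ∧ ((∀ a ∈ A, ∀ b ∈ s \ A, ¬ G.Adj a b) ∨
        ∀ a ∈ A, ∀ b ∈ s \ A, G.Adj a b ∧ S a ⊆ S b) := by
      obtain ⟨A, hAs, hA, hB, h | h⟩ := hasSplit_of_nontrivial h4 s hs
      · exact ⟨A, hAs, hA, hB, Or.inl h⟩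
      · obtain ⟨A', h1, h2, h3, h'⟩ := exists_monotone_join hcomp hP3 hAs hA hB h
        exact ⟨A', h1, h2, h3, Or.inr h'⟩
    obtain ⟨A, hAs, ⟨a, ha⟩, ⟨b, hb⟩, h⟩ := main
    obtain ⟨T₁, h₁⟩ := ih A.ncard
      (hn ▸ Set.ncard_lt_ncard ⟨hAs, fun hh => hb.2 (hh hb.1)⟩ (Set.toFinite s)) A rfl
    obtain ⟨T₂, h₂⟩ := ih (s \ A).ncard
      (hn ▸ Set.ncard_lt_ncard ⟨Set.sdiff_subset, fun hh => (hh (hAs ha)).2 ha⟩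
        (Set.toFinite s)) (s \ A) rfl
    exact exists_isMonotoneOrientation_of_split h₁ h₂ hAs h
  · rw [Set.not_nontrivial_iff] at hs
    exact ⟨fun _ _ => False, by simp, by simp, by simp,
      fun x hx y hy hxy => absurd (hs hx hy) hxy.ne, by simp, by simp⟩

/-! ### Distance levels -/

/-- A distribution of the vertices into levels, as by the distance from a root chosen in each
connected component; `root x` is the root of the component of `x`. -/
structure Levelling (G : SimpleGraph V) where
  root : V → V
  level : V → ℕ
  root_eq : ∀ {x y}, G.Adj x y → root x = root y
  level_le : ∀ {x y}, G.Adj x y → level x ≤ level y + 1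
  eq_root : ∀ {x}, level x = 0 → x = root x
  exists_lower : ∀ {x}, level x ≠ 0 → ∃ y, G.Adj x y ∧ level y + 1 = level x

theorem exists_adj_dist_add_one_eq {x r : V} (h : G.Reachable x r) (h0 : G.dist x r ≠ 0) :
    ∃ y, G.Adj x y ∧ G.dist y r + 1 = G.dist x r := by
  obtain ⟨w, hw⟩ := h.exists_walk_length_eq_dist
  cases w with
  | nil => exact absurd hw.symm h0
  | @cons _ y _ hadj w' =>
    refine ⟨y, hadj, ?_⟩
    have h1 := G.dist_le w'
    obtain ⟨w₂, hw₂⟩ := (hadj.reachable.symm.trans h).exists_walk_length_eq_dist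
    have h3 := G.dist_le (Walk.cons hadj w₂)
    simp only [Walk.length_cons] at *
    omega

/-- The levelling by the distance from a given representative of each connected component. -/
noncomputable def distLevelling (G : SimpleGraph V) (r : G.ConnectedComponent → V)
    (hr : ∀ C, G.connectedComponentMk (r C) = C) : Levelling G where
  root x := r (G.connectedComponentMk x)
  level x := G.dist x (r (G.connectedComponentMk x))
  root_eq h := by rw [ConnectedComponent.connectedComponentMk_eq_of_adj h]
  level_le {x y} h := by
    rw [ConnectedComponent.connectedComponentMk_eq_of_adj h]
    have hy : G.Reachable y (r (G.connectedComponentMk y)) :=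
      ConnectedComponent.exact (hr _).symm
    obtain ⟨w, hw⟩ := hy.exists_walk_length_eq_dist
    rw [← hw]
    exact G.dist_le (Walk.cons h w)
  eq_root {x} h := by
    have hx : G.Reachable x (r (G.connectedComponentMk x)) :=
      ConnectedComponent.exact (hr _).symm
    exact hx.dist_eq_zero_iff.1 h
  exists_lower {x} h := by
    obtain ⟨y, hy, hd⟩ := exists_adj_dist_add_one_eq (ConnectedComponent.exact (hr _).symm) h
    refine ⟨y, hy, ?_⟩
    rw [← ConnectedComponent.connectedComponentMk_eq_of_adj hy]
    exact hd

namespace Levelling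

variable (L : Levelling G)
include L

theorem level_ne_zero_of_adj {x y : V} (h : G.Adj x y) (hl : L.level x = L.level y) :
    L.level x ≠ 0 := by
  intro h0
  exact h.ne ((L.eq_root h0).trans ((L.root_eq h).trans (L.eq_root (hl ▸ h0)).symm))

theorem level_cases {x y : V} (h : G.Adj x y) :
    L.level y + 1 = L.level x ∨ L.level y = L.level x ∨ L.level y = L.level x + 1 := by
  have := L.level_le h
  have := L.level_le h.symm
  omega

theorem reachable_root {k : ℕ} (y : V) (hy : L.level y < k) :
    (G.within {z | L.level z < k}).Reachable y (L.root y) := by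
  induction h : L.level y generalizing y with
  | zero => rw [← L.eq_root h]
  | succ n ih =>
    obtain ⟨z, hz, hl⟩ := L.exists_lower (x := y) (by omega)
    rw [L.root_eq hz]
    have hyz : (G.within {z | L.level z < k}).Adj y z := ⟨hy, show L.level z < k by omega, hz⟩
    exact hyz.reachable.trans (ih z (by omega) (by omega))

theorem reachable_of_level_lt {k : ℕ} {y z : V} (hy : L.level y < k) (hz : L.level z < k)
    (h : L.root y = L.root z) : (G.within {z | L.level z < k}).Reachable y z :=
  (L.reachable_root y hy).trans (h ▸ (L.reachable_root z hz).symm)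

variable (hG : G.IsDistanceHereditary)
include hG

/-- Two nonadjacent lower neighbours of a vertex have a common lower neighbour. -/
theorem exists_common_lower {x p q : V} (hp : G.Adj x p) (hq : G.Adj x q)
    (hlp : L.level p + 1 = L.level x) (hlq : L.level q + 1 = L.level x)
    (hpq : ¬ G.Adj p q) (hne : p ≠ q) :
    ∃ s, G.Adj p s ∧ G.Adj q s ∧ L.level s + 1 = L.level p := by
  have hroot : L.root p = L.root q := (L.root_eq hp).symm.trans (L.root_eq hq)
  have h0 : L.level p ≠ 0 := by
    intro h0
    exact hne ((L.eq_root h0).trans (hroot.trans (L.eq_root (by omega)).symm))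
  obtain ⟨p', hp', hlp'⟩ := L.exists_lower h0
  obtain ⟨q', hq', hlq'⟩ := L.exists_lower (x := q) (by omega)
  set B : Set V := {z | L.level z < L.level p}
  have hp'B : p' ∈ B := by show L.level p' < L.level p; omega
  have hq'B : q' ∈ B := by show L.level q' < L.level p; omega
  have hr : (G.within (insert p (insert q B))).Reachable p q := by
    have h1 : (G.within (insert p (insert q B))).Adj p p' := ⟨by simp, by simp [hp'B], hp'⟩
    have h2 : (G.within (insert p (insert q B))).Adj q q' := ⟨by simp, by simp [hq'B], hq'⟩
    have h3 : (G.within B).Reachable p' q' := L.reachable_of_level_lt hp'B hq'B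
      ((L.root_eq hp').symm.trans (hroot.trans (L.root_eq hq')))
    exact (h1.reachable.trans (h3.mono (within_mono fun z hz => by simp [hz]))).trans
      h2.symm.reachable
  obtain ⟨s, hs, hps, hqs⟩ := hG.exists_common_neighbor hp hq hpq hne (B := B) (fun b hb hxb => by
    have := L.level_le hxb
    have : L.level b < L.level p := hb
    omega) (fun hx => by
    have : L.level x < L.level p := hx
    omega) hr
  refine ⟨s, hps, hqs, ?_⟩
  have : L.level s < L.level p := hs
  have := L.level_le hps
  omega

/-- Lower neighbours `p`, `q` of two adjacent vertices `x`, `y` of one level close a hole, unless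
there is a further edge among the four. -/
theorem adj_of_lower_of_lower {x y p q : V} (hxy : G.Adj x y) (hl : L.level x = L.level y)
    (hp : G.Adj x p) (hq : G.Adj y q)
    (hlp : L.level p + 1 = L.level x) (hlq : L.level q + 1 = L.level y)
    (hyp : ¬ G.Adj y p) (hxq : ¬ G.Adj x q) : G.Adj p q := by
  by_contra hpq
  have hroot : L.root p = L.root q :=
    (L.root_eq hp).symm.trans ((L.root_eq hxy).trans (L.root_eq hq))
  have h0 : L.level p ≠ 0 := by
    intro h0
    exact hyp ((L.eq_root h0).trans (hroot.trans (L.eq_root (by omega)).symm) ▸ hq)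
  obtain ⟨p', hp', hlp'⟩ := L.exists_lower h0
  obtain ⟨q', hq', hlq'⟩ := L.exists_lower (x := q) (by omega)
  set B : Set V := {z | L.level z < L.level p}
  have hp'B : p' ∈ B := by show L.level p' < L.level p; omega
  have hq'B : q' ∈ B := by show L.level q' < L.level p; omega
  have hr : (G.within (insert p (insert y (insert q B)))).Reachable p y := by
    have h1 : (G.within (insert p (insert y (insert q B)))).Adj p p' :=
      ⟨by simp, by simp [hp'B], hp'⟩
    have h2 : (G.within (insert p (insert y (insert q B)))).Adj q q' :=
      ⟨by simp, by simp [hq'B], hq'⟩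
    have h4 : (G.within (insert p (insert y (insert q B)))).Adj y q := ⟨by simp, by simp, hq⟩
    have h3 : (G.within B).Reachable p' q' := L.reachable_of_level_lt hp'B hq'B
      ((L.root_eq hp').symm.trans (hroot.trans (L.root_eq hq')))
    exact ((h1.reachable.trans (h3.mono (within_mono fun z hz => by simp [hz]))).trans
      h2.symm.reachable).trans h4.symm.reachable
  obtain ⟨s, hs, hps, hys⟩ := hG.exists_common_neighbor hp hxy (fun h => hyp h.symm)
    (fun h => by rw [h] at hlp; omega) (B := insert q B) (by
      rintro b (rfl | hb) hxb
      · exact hxq hxb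
      · have := L.level_le hxb
        have : L.level b < L.level p := hb
        omega) (by
      rintro (rfl | hx)
      · omega
      · have : L.level x < L.level p := hx
        omega) hr
  rcases hs with rfl | hs
  · exact hpq hps
  · have : L.level s < L.level p := hs
    have := L.level_le hys
    omega

/-- Adjacent vertices of one level have the same lower neighbours. -/
theorem adj_lower {x y p : V} (hxy : G.Adj x y) (hl : L.level x = L.level y)
    (hp : G.Adj x p) (hlp : L.level p + 1 = L.level x) : G.Adj y p := by
  induction hk : L.level x using Nat.strong_induction_on generalizing x y p with
  | _ k ih =>
  by_contra hyp
  obtain ⟨q, hq, hlq⟩ := L.exists_lower (x := y)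
    (fun h => L.level_ne_zero_of_adj hxy hl (hl.trans h))
  have hne : p ≠ q := by rintro rfl; exact hyp hq
  by_cases hxq : G.Adj x q
  · by_cases hpq : G.Adj p q
    · obtain ⟨s, hs, hls⟩ := L.exists_lower (L.level_ne_zero_of_adj hpq (by omega))
      have hqs := ih (L.level p) (by omega) hpq (by omega) hs hls rfl
      refine hG.false_of_gem (a := s) (b := p) (c := x) (d := y) (u := q)
        ⟨hs.symm, hp.symm, hxy, ?_, fun h => hyp h.symm, ?_⟩ hqs hpq.symm hxq.symm hq.symm
      · intro h; have := L.level_le h.symm; omega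
      · intro h; have := L.level_le h.symm; omega
    · obtain ⟨s, hps, hqs, hls⟩ := L.exists_common_lower hG hp hxq hlp (by omega) hpq hne
      refine hG.false_of_house (a := x) (b := q) (c := s) (d := p) (e := y)
        hxq hqs hps.symm hp.symm ?_ (fun h => hpq h.symm) hxy.symm hq ?_ hyp
      · intro h; have := L.level_le h; omega
      · intro h; have := L.level_le h; omega
  · have hpq := L.adj_of_lower_of_lower hG hxy hl hp hq hlp hlq hyp hxq
    obtain ⟨s, hs, hls⟩ := L.exists_lower (L.level_ne_zero_of_adj hpq (by omega))
    have hqs := ih (L.level p) (by omega) hpq (by omega) hs hls rfl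
    refine hG.false_of_house (a := p) (b := q) (c := y) (d := x) (e := s)
      hpq hq.symm hxy.symm hp (fun h => hyp h.symm) (fun h => hxq h.symm) hs.symm hqs.symm ?_ ?_
    · intro h; have := L.level_le h.symm; omega
    · intro h; have := L.level_le h.symm; omega

theorem exists_common_lower_of_adj {x y : V} (hxy : G.Adj x y) (hl : L.level x = L.level y) :
    ∃ p, G.Adj x p ∧ G.Adj y p ∧ L.level p + 1 = L.level x := by
  obtain ⟨p, hp, hlp⟩ := L.exists_lower (L.level_ne_zero_of_adj hxy hl)
  exact ⟨p, hp, L.adj_lower hG hxy hl hp hlp, hlp⟩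

omit hG
/-- The subgraph of the edges with both ends in one level. -/
def sameLevel : SimpleGraph V where
  Adj x y := G.Adj x y ∧ L.level x = L.level y
  symm := ⟨fun _ _ h => ⟨h.1.symm, h.2.symm⟩⟩
  loopless := ⟨fun _ h => G.irrefl h.1⟩

/-- The neighbours of `x` in the next level. -/
def upper (x : V) : Set V := {c | G.Adj x c ∧ L.level c = L.level x + 1}
include hG

/-- An induced path in a level and a common lower neighbour of its vertices form a gem. -/
theorem not_isInducedP4_sameLevel (a b c d : V) : ¬ L.sameLevel.IsInducedP4 a b c d := by
  rintro ⟨⟨hab, lab⟩, ⟨hbc, lbc⟩, ⟨hcd, lcd⟩, hac, hbd, had⟩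
  obtain ⟨p, hap, hbp, hlp⟩ := L.exists_common_lower_of_adj hG hab lab
  have hcp := L.adj_lower hG hbc lbc hbp (by omega)
  have hdp := L.adj_lower hG hcd lcd hcp (by omega)
  exact hG.false_of_gem ⟨hab, hbc, hcd, fun h => hac ⟨h, by omega⟩, fun h => hbd ⟨h, by omega⟩,
    fun h => had ⟨h, by omega⟩⟩ hap.symm hbp.symm hcp.symm hdp.symm

theorem not_mem_upper_of_path {x y z c : V} (hxy : L.sameLevel.Adj x y)
    (hyz : L.sameLevel.Adj y z) (hxz : ¬ L.sameLevel.Adj x z) (hx : c ∉ L.upper x)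
    (hy : c ∈ L.upper y) : c ∉ L.upper z := by
  rintro ⟨hzc, -⟩
  obtain ⟨hxy, lxy⟩ := hxy
  obtain ⟨hyz, lyz⟩ := hyz
  obtain ⟨hyc, lc⟩ := hy
  obtain ⟨p, hxp, hyp, hlp⟩ := L.exists_common_lower_of_adj hG hxy lxy
  have hzp := L.adj_lower hG hyz lyz hyp (by omega)
  refine hG.false_of_gem (a := x) (b := p) (c := z) (d := c) (u := y)
    ⟨hxp, hzp.symm, hzc, fun h => hxz ⟨h, by omega⟩, ?_, fun h => hx ⟨h, by omega⟩⟩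
    hxy.symm hyp hyz hyc
  intro h; have := L.level_le h.symm; omega

theorem upper_subset_of_path {x y z : V} (hxy : L.sameLevel.Adj x y)
    (hyz : L.sameLevel.Adj y z) (hxz : ¬ L.sameLevel.Adj x z) (h : L.upper y ⊆ L.upper x) :
    L.upper y ⊆ L.upper z := by
  intro c hcy
  by_contra hcz
  exact L.not_mem_upper_of_path hG hyz.symm hxy.symm (fun k => hxz k.symm) hcz hcy (h hcy)

end Levelling

/-! ### Roots -/

/-- `v` is the nose of an induced bull: the vertex of degree two on a triangle whose other two
vertices `a` and `b` have private neighbours `c` and `d`. -/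
def IsBullNose (G : SimpleGraph V) (v : V) : Prop :=
  ∃ a b c d, G.IsInducedP4 c a b d ∧ G.Adj v a ∧ G.Adj v b ∧ ¬ G.Adj v c ∧ ¬ G.Adj v d

/-- A vertex of the last level is no nose if its lower neighbourhood is smallest. -/
theorem Levelling.not_isBullNose (L : Levelling G) (hG : G.IsDistanceHereditary) {v : V}
    (hmax : ∀ x, L.root x = L.root v → L.level x ≤ L.level v)
    (hmin : ∀ x, L.root x = L.root v → L.level x = L.level v →
      (∀ y, G.Adj x y → L.level y + 1 = L.level x → G.Adj v y) →
      ∀ y, G.Adj v y → L.level y + 1 = L.level v → G.Adj x y) : ¬ G.IsBullNose v := by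
  rintro ⟨a, b, c, d, ⟨hca, hab, hbd, hcb, had, hcd⟩, hva, hvb, hvc, hvd⟩
  have ra := L.root_eq hva
  have rb := L.root_eq hvb
  have rc := L.root_eq hca
  have rd := L.root_eq hbd
  have ma := hmax a (by rw [ra])
  have mb := hmax b (by rw [rb])
  have mc := hmax c (by rw [ra, rc])
  have md := hmax d (by rw [rb, rd])
  -- Levels cannot increase from `v`. If `v` and `a` are in one level, then so is `c`, and
  -- likewise for `b` and `d`, by the equality of lower neighbourhoods.
  rcases L.level_cases hva with la | la | la
  · rcases L.level_cases hvb with lb | lb | lb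
    · obtain ⟨p, hap, hbp, hlp⟩ := L.exists_common_lower_of_adj hG hab (by omega)
      have hvp : ¬ G.Adj v p := fun h => by have := L.level_le h; omega
      rcases L.level_cases hca.symm with lc | lc | lc
      · exact hcb (L.adj_lower hG hab (by omega) hca.symm lc).symm
      · have hcp := L.adj_lower hG hca.symm lc.symm hap hlp
        exact hG.false_of_gem (a := v) (b := b) (c := p) (d := c) (u := a)
          ⟨hvb, hbp, hcp.symm, hvp, fun h => hcb h.symm, hvc⟩ hva.symm hab hap hca.symm
      · -- As `b` is a lower neighbour of `v` but not of `c`, minimality of the lower neighbourhood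
        -- of `v` provides a lower neighbour `e` of `c` that is not one of `v`.
        have : ∃ e, G.Adj c e ∧ L.level e + 1 = L.level c ∧ ¬ G.Adj v e := by
          by_contra! hcon
          exact hcb (hmin c (by rw [ra, rc]) (by omega) hcon b hvb lb)
        obtain ⟨e, hce, le, hve⟩ := this
        by_cases hea : G.Adj e a
        · by_cases heb : G.Adj e b
          · exact hG.false_of_gem (a := v) (b := b) (c := e) (d := c) (u := a)
              ⟨hvb, heb.symm, hce.symm, hve, fun h => hcb h.symm, hvc⟩
              hva.symm hab hea.symm hca.symm
          · have hep := L.adj_lower hG hea.symm (by omega) hap hlp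
            exact hG.false_of_gem (a := b) (b := p) (c := e) (d := c) (u := a)
              ⟨hbp, hep.symm, hce.symm, fun h => heb h.symm,
                fun h => by have := L.level_le h.symm; omega, fun h => hcb h.symm⟩
              hab hap hea.symm hca.symm
        · by_cases heb : G.Adj e b
          · exact hG.false_of_house (a := a) (b := b) (c := e) (d := c) (e := v)
              hab heb.symm hce.symm hca (fun h => hea h.symm) (fun h => hcb h.symm) hva hvb hve hvc
          · obtain ⟨s, hes, has, hls⟩ := L.exists_common_lower hG hce hca le (by omega) hea
              (fun h => hve (h ▸ hva))
            have hbs := L.adj_lower hG hab (by omega) has (by omega)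
            exact hG.false_of_house (a := a) (b := s) (c := e) (d := c) (e := b)
              has hes.symm hce.symm hca (fun h => hea h.symm)
              (fun h => by have := L.level_le h.symm; omega) hab.symm hbs
              (fun h => heb h.symm) (fun h => hcb h.symm)
    · rcases L.level_cases hbd with ld | ld | ld
      · exact hvd (L.adj_lower hG hvb.symm lb hbd ld)
      · exact had (L.adj_lower hG hbd ld.symm hab.symm (by omega)).symm
      · omega
    · omega
  · rcases L.level_cases hca.symm with lc | lc | lc
    · exact hvc (L.adj_lower hG hva.symm la hca.symm lc)
    · rcases L.level_cases hvb with lb | lb | lb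
      · exact hcb (L.adj_lower hG hca.symm lc.symm hab (by omega))
      · rcases L.level_cases hbd with ld | ld | ld
        · exact hvd (L.adj_lower hG hvb.symm lb hbd ld)
        · exact L.not_isInducedP4_sameLevel hG c a b d ⟨⟨hca, lc⟩, ⟨hab, by omega⟩,
            ⟨hbd, ld.symm⟩, fun h => hcb h.1, fun h => had h.1, fun h => hcd h.1⟩
        · omega
      · omega
    · omega
  · omega

theorem IsDistanceHereditary.exists_not_isBullNose [Finite V] (hG : G.IsDistanceHereditary)
    (C : G.ConnectedComponent) : ∃ v, G.connectedComponentMk v = C ∧ ¬ G.IsBullNose v := by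
  let L : Levelling G := G.distLevelling (fun C => C.out) fun C => C.out_eq
  have hroot : ∀ x y, L.root x = L.root y ↔
      G.connectedComponentMk x = G.connectedComponentMk y := by
    intro x y
    refine ⟨fun h => ?_, fun h => by show Quot.out _ = Quot.out _; rw [h]⟩
    have := congrArg G.connectedComponentMk h
    exact (Quot.out_eq _).symm.trans (this.trans (Quot.out_eq _))
  obtain ⟨u, hu, humax⟩ := (Set.toFinite {x | G.connectedComponentMk x = C}).exists_maximalFor
    L.level _ ⟨C.out, C.out_eq⟩
  let N : V → Set V := fun x => {y | G.Adj x y ∧ L.level y + 1 = L.level x}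
  obtain ⟨v, ⟨hvC, hvu⟩, hvmin⟩ :=
    (Set.toFinite {x | G.connectedComponentMk x = C ∧ L.level x = L.level u}).exists_minimalFor
      N _ ⟨u, hu, rfl⟩
  refine ⟨v, hvC, L.not_isBullNose hG (fun x hx => ?_) fun x hx hl hsub y hy hly => ?_⟩
  · rw [hroot, hvC] at hx
    rw [hvu]
    exact (le_total _ _).elim id fun h => humax hx h
  · rw [hroot, hvC] at hx
    exact (hvmin ⟨hx, hl.trans hvu⟩ (fun z hz => ⟨hsub z hz.1 hz.2, by rw [← hl]; exact hz.2⟩)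
      ⟨hy, hly⟩).1

/-! ### The transitive orientation -/

/-- If two adjacent vertices of one level had incomparable upper neighbourhoods, they would span a
bull together with a common lower neighbour as nose. Below the first level, the nose has itself a
lower neighbour, which completes a net. -/
theorem Levelling.upper_comparable (L : Levelling G) (hG : G.IsDistanceHereditary)
    (hN : ¬ netGraph.IsIndContained G) (hroot : ∀ x, ¬ G.IsBullNose (L.root x)) (x y : V)
    (hxy : L.sameLevel.Adj x y) : L.upper x ⊆ L.upper y ∨ L.upper y ⊆ L.upper x := by
  by_contra! hcon
  obtain ⟨⟨c, ⟨hxc, lc⟩, hcy⟩, ⟨d, ⟨hyd, ld⟩, hdx⟩⟩ :=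
    And.imp Set.not_subset.1 Set.not_subset.1 hcon
  obtain ⟨hxy, lxy⟩ := hxy
  have hyc : ¬ G.Adj y c := fun h => hcy ⟨h, by omega⟩
  have hxd : ¬ G.Adj x d := fun h => hdx ⟨h, by omega⟩
  have hcd : ¬ G.Adj c d := fun h => hxd (L.adj_lower hG h (by omega) hxc.symm (by omega)).symm
  obtain ⟨p, hxp, hyp, hlp⟩ := L.exists_common_lower_of_adj hG hxy lxy
  have hpc : ¬ G.Adj p c := fun h => by have := L.level_le h.symm; omega
  have hpd : ¬ G.Adj p d := fun h => by have := L.level_le h.symm; omega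
  by_cases h0 : L.level p = 0
  · refine hroot p ?_
    rw [← L.eq_root h0]
    exact ⟨x, y, c, d, ⟨hxc.symm, hxy, hyd, fun h => hyc h.symm, hxd, hcd⟩, hxp.symm, hyp.symm,
      hpc, hpd⟩
  · obtain ⟨q, hq, hlq⟩ := L.exists_lower h0
    have hlow : ∀ z, L.level p < L.level z → ¬ G.Adj z q := fun z hz h => by
      have := L.level_le h; omega
    exact hN (isIndContained_netGraph hxp.symm hxy hyp.symm hq hxc hyd hpc hpd
      (hlow x (by omega)) hxd (hlow y (by omega)) hyc
      (fun h => hlow c (by omega) h.symm) (fun h => hlow d (by omega) h.symm) hcd)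

/-- The arcs lead from even to odd levels; within the odd levels they follow `T`, and within the
even levels they are opposite to `T`. -/
def Levelling.arc (L : Levelling G) (T : V → V → Prop) (x y : V) : Prop :=
  (G.Adj x y ∧ L.level x ≠ L.level y ∧ Even (L.level x)) ∨
  (Odd (L.level x) ∧ T x y) ∨ (Even (L.level x) ∧ T y x)

theorem Levelling.arc_trans (L : Levelling G) (hG : G.IsDistanceHereditary) {T : V → V → Prop}
    (hT : L.sameLevel.IsMonotoneOrientation L.upper Set.univ T) {x y z : V}
    (hxy : L.arc T x y) (hyz : L.arc T y z) : L.arc T x z := by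
  -- the lower and upper neighbours of the tail of an arc of `T` are neighbours of its head
  have key : ∀ u v w, T u v → G.Adj u w → L.level u ≠ L.level w → G.Adj v w := by
    intro u v w huv huw hl
    obtain ⟨ha, hl'⟩ := hT.adj u v huv
    rcases L.level_cases huw with h | h | h
    · exact L.adj_lower hG ha hl' huw h
    · exact absurd h.symm hl
    · exact (hT.subset u v huv ⟨huw, h⟩).1
  have hodd : ∀ {u v}, G.Adj u v → L.level u ≠ L.level v → Even (L.level u) →
      Odd (L.level v) := by
    intro u v huv hl he
    rcases L.level_cases huv with h | h | h
    · rw [← h] at he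
      exact Nat.not_even_iff_odd.1 (Nat.even_add_one.1 he)
    · exact absurd h.symm hl
    · rw [h]; exact he.add_one
  have hlev : ∀ {u v}, T u v → L.level u = L.level v := fun h => (hT.adj _ _ h).2
  rcases hxy with ⟨ha, hl, he⟩ | ⟨ho, ht⟩ | ⟨he, ht⟩
  · have hy := hodd ha hl he
    rcases hyz with ⟨-, -, he'⟩ | ⟨-, ht'⟩ | ⟨he', -⟩
    · exact absurd hy (Nat.not_odd_iff_even.2 he')
    · exact Or.inl ⟨(key y z x ht' ha.symm hl.symm).symm, hlev ht' ▸ hl, he⟩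
    · exact absurd hy (Nat.not_odd_iff_even.2 he')
  · rw [hlev ht] at ho
    rcases hyz with ⟨-, -, he'⟩ | ⟨-, ht'⟩ | ⟨he', -⟩
    · exact absurd ho (Nat.not_odd_iff_even.2 he')
    · exact Or.inr (Or.inl ⟨hlev ht ▸ ho, hT.trans _ _ _ ht ht'⟩)
    · exact absurd ho (Nat.not_odd_iff_even.2 he')
  · rcases hyz with ⟨ha, hl, -⟩ | ⟨ho', -⟩ | ⟨-, ht'⟩
    · exact Or.inl ⟨key y x z ht ha hl, hlev ht ▸ hl, he⟩
    · exact absurd ho' (Nat.not_odd_iff_even.2 (hlev ht ▸ he))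
    · exact Or.inr (Or.inr ⟨he, hT.trans _ _ _ ht' ht⟩)

theorem Levelling.isComparability (L : Levelling G) (hG : G.IsDistanceHereditary)
    {T : V → V → Prop} (hT : L.sameLevel.IsMonotoneOrientation L.upper Set.univ T) :
    G.IsComparability := by
  have hadj : ∀ x y, L.arc T x y → G.Adj x y := by
    rintro x y (h | h | h)
    · exact h.1
    · exact (hT.adj _ _ h.2).1
    · exact (hT.adj _ _ h.2).1.symm
  have htrans : ∀ x y, Relation.TransGen (L.arc T) x y → L.arc T x y := by
    intro x y h
    induction h with
    | single h => exact h
    | tail _ h ih => exact L.arc_trans hG hT ih h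
  refine ⟨{ Adj := L.arc T }, ⟨⟨fun x y => ⟨fun h => ?_, ?_⟩, fun x y h h' => ?_⟩,
    fun x h => ?_⟩, fun a b c => L.arc_trans hG hT⟩
  · show L.arc T x y ∨ L.arc T y x
    rcases Nat.even_or_odd (L.level x) with he | ho
    · by_cases hl : L.level x = L.level y
      · rcases hT.total x trivial y trivial ⟨h, hl⟩ with k | k
        · exact Or.inr (Or.inr (Or.inr ⟨hl ▸ he, k⟩))
        · exact Or.inl (Or.inr (Or.inr ⟨he, k⟩))
      · exact Or.inl (Or.inl ⟨h, hl, he⟩)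
    · by_cases hl : L.level x = L.level y
      · rcases hT.total x trivial y trivial ⟨h, hl⟩ with k | k
        · exact Or.inl (Or.inr (Or.inl ⟨ho, k⟩))
        · exact Or.inr (Or.inr (Or.inl ⟨hl ▸ ho, k⟩))
      · refine Or.inr (Or.inl ⟨h.symm, Ne.symm hl, ?_⟩)
        rcases L.level_cases h with k | k | k
        · rw [← k] at ho
          exact Nat.not_odd_iff_even.1 (Nat.odd_add_one.1 ho)
        · exact absurd k.symm hl
        · rw [k]; exact ho.add_one
  · rintro (h | h)
    · exact hadj x y h
    · exact (hadj y x h).symm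
  · exact G.irrefl (hadj x x (L.arc_trans hG hT h h'))
  · exact G.irrefl (hadj x x (htrans x x h))

theorem IsDistanceHereditary.isComparability_of_net_free [Finite V] (hG : G.IsDistanceHereditary)
    (hN : ¬ netGraph.IsIndContained G) : G.IsComparability := by
  choose r hr hrN using hG.exists_not_isBullNose
  let L : Levelling G := G.distLevelling r hr
  have hcomp := L.upper_comparable hG hN fun x => hrN _
  obtain ⟨T, hT⟩ := exists_isMonotoneOrientation (L.not_isInducedP4_sameLevel hG) hcomp
    (fun x y z hxy hyz _ hxz h => L.upper_subset_of_path hG hxy hyz hxz h) Set.univ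
  exact L.isComparability hG hT

/-! ### The remaining implications -/

/-- In a transitive orientation the middle vertex of an induced path with two edges is a source or
a sink, so the arcs alternate along every induced path. -/
theorem IsComparability.isCoalition (h : G.IsComparability) : G.IsCoalition := by
  obtain ⟨D, hD, htr⟩ := h
  have flip : ∀ a b c, G.Adj b c → ¬ G.Adj a c → D.Adj a b → D.Adj c b := by
    intro a b c hbc hac hab
    rcases (hD.adj_iff b c).1 hbc with h | h
    · exact absurd ((hD.adj_iff a c).2 (Or.inl (htr a b c hab h))) hac
    · exact h
  have flip' : ∀ a b c, G.Adj b c → ¬ G.Adj a c → D.Adj b a → D.Adj b c := by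
    intro a b c hbc hac hab
    rcases (hD.adj_iff b c).1 hbc with h | h
    · exact h
    · exact absurd ((hD.adj_iff a c).2 (Or.inr (htr c b a h hab))) hac
  refine ⟨D, hD, fun a b c d hP => ⟨fun h => ?_, fun h => ?_⟩⟩
  · exact flip' b c d hP.adj_cd hP.not_adj_bd (flip a b c hP.adj_bc hP.not_adj_ac h)
  · exact flip c b a hP.adj_ab.symm (fun h => hP.not_adj_ac h.symm)
      (flip' d c b hP.adj_bc.symm (fun h => hP.not_adj_bd h.symm) h)

/-- The pairs are coloured according to whether they are arcs of the orientation. -/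
theorem IsCoalition.isBipartite_coalitionAux (h : G.IsCoalition) :
    G.coalitionAux.IsBipartite := by
  classical
  obtain ⟨D, hD, hP4⟩ := h
  have hflip : ∀ x y, G.Adj x y → (D.Adj x y ↔ ¬ D.Adj y x) := fun x y hxy =>
    ⟨hD.asymm x y, fun h => ((hD.adj_iff x y).1 hxy).resolve_right h⟩
  refine ⟨Coloring.mk (fun p => if D.Adj p.1.1 p.1.2 then (0 : Fin 2) else 1) ?_⟩
  rintro ⟨⟨x, y⟩, hxy⟩ ⟨⟨u, v⟩, huv⟩ hadj
  have key : D.Adj x y ↔ ¬ D.Adj u v := by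
    rcases hadj with h | h | h
    · simp only [Prod.mk.injEq] at h
      obtain ⟨rfl, rfl⟩ := h
      obtain ⟨a, b, c, d, hP, he⟩ := hxy
      refine hflip x y ?_
      rw [← mem_edgeSet]
      rcases he with he | he
      · rw [he]; exact hP.adj_ab
      · rw [he]; exact hP.adj_cd
    · exact (hP4 _ _ _ _ h).trans (hflip _ _ h.adj_cd)
    · exact (hP4 _ _ _ _ h).symm.trans (hflip _ _ h.adj_ab)
  by_cases h : D.Adj u v <;> simp [h, key]

/-- The three pendant edges of a net, directed towards the triangle, form a triangle of the
auxiliary graph. -/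
theorem not_isIndContained_netGraph (h : G.coalitionAux.IsBipartite) :
    ¬ netGraph.IsIndContained G := by
  rintro ⟨f⟩
  obtain ⟨C⟩ := h
  have hadj : ∀ i j, G.Adj (f i) (f j) ↔ netGraph.Adj i j := fun i j => f.map_adj_iff
  have hP : ∀ i j i' j' : Fin 6, (i : ℕ) < 3 → (j : ℕ) < 3 → i ≠ j → (i' : ℕ) = i + 3 →
      (j' : ℕ) = j + 3 → G.IsInducedP4 (f i') (f i) (f j) (f j') := by
    intro i j i' j' hi hj hij hi' hj'
    have hij' : (i : ℕ) ≠ j := fun h => hij (Fin.ext h)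
    constructor <;> rw [hadj, netGraph_adj] <;> simp only [ne_eq, Fin.ext_iff] <;> omega
  have h01 := hP 0 1 3 4 (by decide) (by decide) (by decide) rfl rfl
  have h02 := hP 0 2 3 5 (by decide) (by decide) (by decide) rfl rfl
  have h12 := hP 1 2 4 5 (by decide) (by decide) (by decide) rfl rfl
  let p₀ : {p : V × V // G.IsP4EndEdge p.1 p.2} := ⟨(f 3, f 0), _, _, _, _, h01, Or.inl rfl⟩
  let p₁ : {p : V × V // G.IsP4EndEdge p.1 p.2} := ⟨(f 4, f 1), _, _, _, _, h12, Or.inl rfl⟩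
  let p₂ : {p : V × V // G.IsP4EndEdge p.1 p.2} :=
    ⟨(f 5, f 2), _, _, _, _, h12, Or.inr Sym2.eq_swap⟩
  have c01 : C p₀ ≠ C p₁ := C.valid (Or.inr (Or.inl h01))
  have c02 : C p₀ ≠ C p₂ := C.valid (Or.inr (Or.inl h02))
  have c12 : C p₁ ≠ C p₂ := C.valid (Or.inr (Or.inl h12))
  omega

end SimpleGraph

theorem theorem5p2 {V : Type*} [Finite V] (G : SimpleGraph V) (hG : G.IsDistanceHereditary) :
    List.TFAE [
      G.IsCoalition,
      G.coalitionAux.IsBipartite,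
      ¬ SimpleGraph.netGraph.IsIndContained G,
      G.IsComparability] := by
  tfae_have 1 → 2 := SimpleGraph.IsCoalition.isBipartite_coalitionAux
  tfae_have 2 → 3 := SimpleGraph.not_isIndContained_netGraph
  tfae_have 3 → 4 := hG.isComparability_of_net_free
  tfae_have 4 → 1 := SimpleGraph.IsComparability.isCoalition
  tfae_finish
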